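/- Let $H$ be a real separable Hilbert space and let $A,B$ be non-negative definite (self-adjoint) trace-class operators on $H$ with $AB=0$. Let $\mu=N(0,A)$ and $\nu=N(0,B)$ be the centered Gaussian measures on $H$ with covariance operators $A$ and $B$, and let $\Pi(\mu,\nu)$ be the set of all couplings of $\mu$ and $\nu$, i.e. of all probability measures on $H\times H$ with marginals $\mu$ and $\nu$. Then for every $\varepsilon>0$ the independent coupling $\mu\otimes\nu$ minimizes the entropic optimal transport objective $$\pi\;\longmapsto\;\int_{H\times H}\|x-y\|^{2}\,\pi(\mathrm dx\,\mathrm dy)+2\varepsilon\,\mathrm{KL}(\pi\,\|\,\mu\otimes\nu)\in[0,\infty]$$ over $\Pi(\mu,\nu)$, and it is the only minimizer. -/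

import Mathlib

open MeasureTheory ProbabilityTheory InformationTheory
open scoped ENNReal

noncomputable section

/-- The class `𝓑₁⁺(H)`: non-negative definite (self-adjoint) bounded operators with finite trace.
For a non-negative definite operator the sum `∑ ⟪e, A e⟫` does not depend on the orthonormal
basis, and it is the trace norm. -/
def IsNonnegTraceClass {H : Type*} [NormedAddCommGroup H] [InnerProductSpace ℝ H]
    (A : H →L[ℝ] H) : Prop :=
  A.IsPositive ∧
    ∃ (s : Set H) (e : HilbertBasis s ℝ H), Summable fun i : s => inner ℝ (e i) (A (e i))

/-- `μ` is the centered Gaussian measure `N(0, A)` on the Hilbert space `H`. -/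
structure IsCenteredGaussian {H : Type*} [NormedAddCommGroup H] [InnerProductSpace ℝ H]
    [CompleteSpace H] [MeasurableSpace H] [BorelSpace H]
    (μ : Measure H) (A : H →L[ℝ] H) : Prop where
  isGaussian : IsGaussian μ
  mean_eq_zero : ∫ x, x ∂μ = 0
  covariance_eq : covarianceOperator μ = A

/-- The set `Π(μ, ν)` of couplings: measures on the product with marginals `μ` and `ν`.
(If `μ` is a probability measure, so is every coupling.) -/
def couplings {H : Type*} [MeasurableSpace H] (μ ν : Measure H) : Set (Measure (H × H)) :=
  {π | π.fst = μ ∧ π.snd = ν}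

/-- The entropic transport objective
`∫ ‖x - y‖² dπ + 2 ε KL(π ‖ μ ⊗ ν)`, with values in `[0, ∞]`. -/
def eotObjective {H : Type*} [NormedAddCommGroup H] [MeasurableSpace H]
    (ε : ℝ) (μ ν : Measure H) (π : Measure (H × H)) : ℝ≥0∞ :=
  ∫⁻ p, ENNReal.ofReal (‖p.1 - p.2‖ ^ 2) ∂π + ENNReal.ofReal (2 * ε) * klDiv π (μ.prod ν)

/-- `π` is an optimal coupling: it minimizes the objective among all couplings of `μ` and `ν`. -/
def IsOptimalEOTCoupling {H : Type*} [NormedAddCommGroup H] [MeasurableSpace H]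
    (ε : ℝ) (μ ν : Measure H) (π : Measure (H × H)) : Prop :=
  π ∈ couplings μ ν ∧ IsMinOn (eotObjective ε μ ν) (couplings μ ν) π

end

section CovarianceKernel

variable {H : Type*} [NormedAddCommGroup H] [InnerProductSpace ℝ H] [CompleteSpace H]
  [MeasurableSpace H] [BorelSpace H]

/-! The measure `μ` lives on the orthogonal complement of `ker A`, and `ν` lives on the complement
of `range A`, which is `ker A`, because `B A = (A B)* = 0`. So every coupling charges only
orthogonal pairs, where `‖x - y‖² = ‖x‖² + ‖y‖²`. The transport cost then depends on the marginals
alone and only the KL term is left to minimize; it vanishes exactly at `μ ⊗ ν`. Gaussianity enters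
only through finite second moments. -/

theorem ae_inner_eq_zero_of_covarianceOperator_eq_zero {μ : Measure H} (hμ : MemLp id 2 μ)
    {v : H} (hv : covarianceOperator μ v = 0) : ∀ᵐ x ∂μ, inner ℝ v x = 0 := by
  -- `covarianceOperator` is uncentered, so this is a raw second moment and no mean has to be
  -- subtracted.
  have hint : ∫ x, inner ℝ v x * inner ℝ v x ∂μ = 0 := by
    rw [← covarianceOperator_inner hμ, hv, inner_zero_left]
  have hL : MemLp (fun x => inner ℝ v x) 2 μ := hμ.const_inner v
  rw [integral_eq_zero_iff_of_nonneg (fun x => mul_self_nonneg _) (hL.integrable_mul hL)] at hint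
  filter_upwards [hint] with x hx using mul_self_eq_zero.mp hx

/-- The null set for a single `v` depends on `v`. A countable dense subset of `S` gives a common
one, and continuity of the inner product extends the equality to `S`. -/
theorem ae_forall_inner_eq_zero_of_covarianceOperator_eq_zero
    [TopologicalSpace.SeparableSpace H] {μ : Measure H} (hμ : MemLp id 2 μ)
    {S : Set H} (hS : ∀ v ∈ S, covarianceOperator μ v = 0) :
    ∀ᵐ x ∂μ, ∀ v ∈ S, inner ℝ v x = 0 := by
  obtain ⟨c, hcS, hc, hSc⟩ :=
    (TopologicalSpace.IsSeparable.of_separableSpace S).exists_countable_dense_subset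
  have hae : ∀ᵐ x ∂μ, ∀ v ∈ c, inner ℝ v x = 0 := (ae_ball_iff hc).mpr fun v hv =>
    ae_inner_eq_zero_of_covarianceOperator_eq_zero hμ (hS v (hcS hv))
  filter_upwards [hae] with x hx v hv
  have hclosed : IsClosed {v : H | inner ℝ v x = 0} :=
    isClosed_eq (by fun_prop) continuous_const
  exact closure_minimal hx hclosed (hSc hv)

end CovarianceKernel

section Couplings

variable {H : Type*} [MeasurableSpace H]

theorem isProbabilityMeasure_of_mem_couplings {μ ν : Measure H} [IsProbabilityMeasure μ]
    {π : Measure (H × H)} (hπ : π ∈ couplings μ ν) : IsProbabilityMeasure π :=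
  ⟨by rw [← Measure.fst_univ, hπ.1, measure_univ]⟩

theorem prod_mem_couplings (μ ν : Measure H) [IsProbabilityMeasure μ] [IsProbabilityMeasure ν] :
    μ.prod ν ∈ couplings μ ν :=
  ⟨Measure.fst_prod, Measure.snd_prod⟩

/-- If the transport cost takes the same finite value at all couplings, then the independent
coupling is the unique minimizer of the entropic objective. -/
theorem isOptimalEOTCoupling_prod_and_unique_of_cost_const [NormedAddCommGroup H] {μ ν : Measure H}
    [IsProbabilityMeasure μ] [IsProbabilityMeasure ν] {ε : ℝ} (hε : 0 < ε)
    {C : ℝ≥0∞} (hC : C ≠ ∞)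
    (hcost : ∀ π ∈ couplings μ ν, ∫⁻ p, ENNReal.ofReal (‖p.1 - p.2‖ ^ 2) ∂π = C) :
    IsOptimalEOTCoupling ε μ ν (μ.prod ν) ∧
      ∀ π : Measure (H × H), IsOptimalEOTCoupling ε μ ν π → π = μ.prod ν := by
  have hprod := prod_mem_couplings μ ν
  have hval : eotObjective ε μ ν (μ.prod ν) = C := by
    rw [eotObjective, hcost _ hprod, klDiv_self, mul_zero, add_zero]
  refine ⟨⟨hprod, fun π hπ => ?_⟩, fun π hπ => ?_⟩
  · rw [Set.mem_ofPred_eq, hval, eotObjective, hcost π hπ]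
    exact le_self_add
  · have hle := hπ.2 hprod
    rw [Set.mem_ofPred_eq, hval, eotObjective, hcost π hπ.1] at hle
    -- Cancelling `C` in `[0, ∞]` requires it to be finite.
    have hkl : ENNReal.ofReal (2 * ε) * klDiv π (μ.prod ν) = 0 :=
      nonpos_iff_eq_zero.mp ((ENNReal.add_le_add_iff_left hC).mp (by simpa using hle))
    have := isProbabilityMeasure_of_mem_couplings hπ.1
    refine klDiv_eq_zero_iff.mp ((mul_eq_zero.mp hkl).resolve_left ?_)
    exact (ENNReal.ofReal_pos.mpr (by positivity)).ne'

end Couplings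

section OrthogonalMarginals

theorem lintegral_ofReal_norm_sq_ne_top {H : Type*} [NormedAddCommGroup H] [MeasurableSpace H]
    {μ : Measure H} (hμ : MemLp id 2 μ) :
    ∫⁻ x, ENNReal.ofReal (‖x‖ ^ 2) ∂μ ≠ ∞ :=
  hμ.integrable_norm_pow (by norm_num) |>.lintegral_lt_top.ne

variable {H : Type*} [NormedAddCommGroup H] [InnerProductSpace ℝ H]
  [MeasurableSpace H] [BorelSpace H]

theorem lintegral_norm_sub_sq_of_ae_inner_eq_zero {μ ν : Measure H} {π : Measure (H × H)}
    (hπ : π ∈ couplings μ ν) (horth : ∀ᵐ p ∂π, inner ℝ p.1 p.2 = 0) :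
    ∫⁻ p, ENNReal.ofReal (‖p.1 - p.2‖ ^ 2) ∂π =
      ∫⁻ x, ENNReal.ofReal (‖x‖ ^ 2) ∂μ + ∫⁻ y, ENNReal.ofReal (‖y‖ ^ 2) ∂ν := by
  have hmeas : Measurable fun x : H => ENNReal.ofReal (‖x‖ ^ 2) := by fun_prop
  calc ∫⁻ p, ENNReal.ofReal (‖p.1 - p.2‖ ^ 2) ∂π
      = ∫⁻ p, (ENNReal.ofReal (‖p.1‖ ^ 2) + ENNReal.ofReal (‖p.2‖ ^ 2)) ∂π := by
        refine lintegral_congr_ae ?_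
        filter_upwards [horth] with p hp
        rw [← ENNReal.ofReal_add (by positivity) (by positivity), norm_sub_sq_real, hp]
        congr 1
        ring
    _ = _ := by
        have hfst : Measurable fun p : H × H => ENNReal.ofReal (‖p.1‖ ^ 2) :=
          hmeas.comp measurable_fst
        rw [lintegral_add_left hfst, ← hπ.1, ← hπ.2, Measure.fst, Measure.snd,
          lintegral_map hmeas measurable_fst, lintegral_map hmeas measurable_snd]

/-- If the product `A B` of the covariance operators vanishes, then every coupling is
concentrated on pairs of orthogonal vectors. -/
theorem ae_inner_eq_zero_of_mem_couplings [CompleteSpace H]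
    [TopologicalSpace.SeparableSpace H] {μ ν : Measure H}
    (hμ : MemLp id 2 μ) (hν : MemLp id 2 ν)
    (h : covarianceOperator μ ∘L covarianceOperator ν = 0)
    {π : Measure (H × H)} (hπ : π ∈ couplings μ ν) : ∀ᵐ p ∂π, inner ℝ p.1 p.2 = 0 := by
  set A := covarianceOperator μ with hA
  set B := covarianceOperator ν with hB
  have hAs : ∀ x y, inner ℝ (A x) y = inner ℝ x (A y) :=
    (isPositive_covarianceOperator (μ := μ)).isSymmetric
  have hBs : ∀ x y, inner ℝ (B x) y = inner ℝ x (B y) :=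
    (isPositive_covarianceOperator (μ := ν)).isSymmetric
  have hBA (v : H) : B (A v) = 0 := by
    refine ext_inner_right ℝ fun w => ?_
    have hw : A (B w) = 0 := DFunLike.congr_fun h w
    rw [hBs, hAs, hw, inner_zero_right, inner_zero_left]
  have h1 : ∀ᵐ x ∂μ, ∀ v ∈ {v | A v = 0}, inner ℝ v x = 0 :=
    ae_forall_inner_eq_zero_of_covarianceOperator_eq_zero hμ fun v hv => hv
  have h2 : ∀ᵐ y ∂ν, ∀ v ∈ Set.range A, inner ℝ v y = 0 :=
    ae_forall_inner_eq_zero_of_covarianceOperator_eq_zero hν (by rintro _ ⟨v, rfl⟩; exact hBA v)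
  rw [← hπ.1] at h1
  rw [← hπ.2] at h2
  filter_upwards [ae_of_ae_map measurable_fst.aemeasurable h1,
    ae_of_ae_map measurable_snd.aemeasurable h2] with p hp1 hp2
  rw [real_inner_comm]
  -- Being orthogonal to `range A`, `p.2` lies in `ker A` by symmetry of `A`, and `p.1` is
  -- orthogonal to that kernel.
  refine hp1 p.2 (ext_inner_left ℝ fun v => ?_)
  rw [← hAs, hp2 _ ⟨v, rfl⟩, inner_zero_right]

end OrthogonalMarginals

theorem mainTheorem11 {H : Type*} [NormedAddCommGroup H] [InnerProductSpace ℝ H]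
    [CompleteSpace H] [TopologicalSpace.SeparableSpace H] [MeasurableSpace H] [BorelSpace H]
    (A B : H →L[ℝ] H) (hA : IsNonnegTraceClass A) (hB : IsNonnegTraceClass B)
    (hAB : A ∘L B = 0)
    (μ ν : Measure H) (hμ : IsCenteredGaussian μ A) (hν : IsCenteredGaussian ν B)
    (ε : ℝ) (hε : 0 < ε) :
    IsOptimalEOTCoupling ε μ ν (μ.prod ν) ∧
      ∀ π : Measure (H × H), IsOptimalEOTCoupling ε μ ν π → π = μ.prod ν := by
  have := UniformSpace.secondCountable_of_separable H
  have := hμ.isGaussian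
  have := hν.isGaussian
  have hμ2 : MemLp id 2 μ := IsGaussian.memLp_two_id
  have hν2 : MemLp id 2 ν := IsGaussian.memLp_two_id
  have hcov : covarianceOperator μ ∘L covarianceOperator ν = 0 := by
    rw [hμ.covariance_eq, hν.covariance_eq, hAB]
  exact isOptimalEOTCoupling_prod_and_unique_of_cost_const hε
    (ENNReal.add_ne_top.mpr
      ⟨lintegral_ofReal_norm_sq_ne_top hμ2, lintegral_ofReal_norm_sq_ne_top hν2⟩)
    fun _ hπ => lintegral_norm_sub_sq_of_ae_inner_eq_zero hπ
      (ae_inner_eq_zero_of_mem_couplings hμ2 hν2 hcov hπ)
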